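/- Consider a stable matching instance with a finite set $\mathcal M$ of men and a finite set $\mathcal W$ of women. Each person declares a set of acceptable partners of the opposite sex and ranks them in a strict preference list; being single is ranked below every acceptable partner and above every unacceptable one. A matching is stable if nobody is matched to an unacceptable partner and there is no pair $(m,w)$ such that $m$ prefers $w$ to his situation in the matching and $w$ prefers $m$ to her situation in the matching. A stable husband of $w$ is a man matched to $w$ in at least one stable matching. Fix a woman $w$ with a (deterministic) set $A$ of $d_w=|A|$ acceptable men, and popularities $\mathcal D_w(m)>0$ for $m\in A$. The preference lists of the men and of the women other than $w$ are arbitrary and fixed. The preference list of $w$ is random: she draws the men of $A$ one after the other without replacement, from her favourite to her least favourite, each time choosing one of the remaining men with probability proportional to his popularity. Assume that $w$ has at least one stable husband for at least one ordering of $A$. Then she has one for every ordering of $A$; for each ordering let $\mu_{\mathcal W}(w)$ and $\mu_{\mathcal M}(w)$ be her best and her worst stable husband, according to that ordering. Then \[\mathbb E[\text{number of stable husbands of } w]\;\le\; 1+\ln d_w+\mathbb E\!\left[\ln\frac{\mathcal D_w(\mu_{\mathcal W}(w))}{\mathcal D_w(\mu_{\mathcal M}(w))}\right],\] where the expectations are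 over the random preference list of $w$. -/

import Mathlib

/-- A preference list over `α`: the acceptable partners, without repetition, in strictly
decreasing order of preference. Partners that do not occur in the list are unacceptable. -/
abbrev PrefList (α : Type*) := {l : List α // l.Nodup}

namespace PrefList

variable {α : Type*} [DecidableEq α]

/-- The set of acceptable partners. -/
def acceptable (p : PrefList α) : Finset α := p.1.toFinset

/-- `p.Prefers x y`: a person with list `p` strictly prefers `x` to `y`, where `none` stands for
remaining single. Acceptable partners are preferred to `none`, which is preferred to the
unacceptable ones. -/
def Prefers (p : PrefList α) : Option α → Option α → Prop
  | none, none => False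
  | none, some b => b ∉ p.1
  | some a, none => a ∈ p.1
  | some a, some b => a ∈ p.1 ∧ (b ∈ p.1 → p.1.idxOf a < p.1.idxOf b)

end PrefList

/-- A matching between the men `M` and the women `W`; `none` means single. -/
structure Matching (M W : Type*) where
  wife : M → Option W
  husband : W → Option M
  consistent : ∀ m w, wife m = some w ↔ husband w = some m

section Stability

variable {M W : Type*} [DecidableEq M] [DecidableEq W]

/-- Stability for the preference lists `pM` of the men and `pW` of the women: nobody prefers being
single to the assigned partner, and no man-woman pair is blocking. -/
def Matching.IsStable (μ : Matching M W) (pM : M → PrefList W) (pW : W → PrefList M) : Prop :=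
  (∀ m, ¬ (pM m).Prefers none (μ.wife m)) ∧
  (∀ w, ¬ (pW w).Prefers none (μ.husband w)) ∧
  ∀ m w, ¬ ((pW w).Prefers (some m) (μ.husband w) ∧ (pM m).Prefers (some w) (μ.wife m))

/-- `m` is the partner of `w` in some stable matching. -/
def IsStableHusband (pM : M → PrefList W) (pW : W → PrefList M) (w : W) (m : M) : Prop :=
  ∃ μ : Matching M W, μ.IsStable pM pW ∧ μ.husband w = some m

/-- The number of stable husbands of `w`. -/
noncomputable def numStableHusbands (pM : M → PrefList W) (pW : W → PrefList M) (w : W) : ℕ :=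
  Set.ncard {m | IsStableHusband pM pW w m}

/-- `m` is the best stable husband of `w`: she prefers him to all her other stable husbands. -/
def IsBestStableHusband (pM : M → PrefList W) (pW : W → PrefList M) (w : W) (m : M) : Prop :=
  IsStableHusband pM pW w m ∧
    ∀ m', IsStableHusband pM pW w m' → m' ≠ m → (pW w).Prefers (some m) (some m')

/-- `m` is the worst stable husband of `w`: she prefers all her other stable husbands to him. -/
def IsWorstStableHusband (pM : M → PrefList W) (pW : W → PrefList M) (w : W) (m : M) : Prop :=
  IsStableHusband pM pW w m ∧
    ∀ m', IsStableHusband pM pW w m' → m' ≠ m → (pW w).Prefers (some m') (some m)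

end Stability

section Popularity

variable {M : Type*} [DecidableEq M]

/-- The probability that drawing without replacement from `A` until `A` is exhausted, each draw
picking a remaining man `a` with probability proportional to his popularity `D a`, produces the
men in the order given by the list. -/
noncomputable def drawProb (D : M → ℝ) : Finset M → List M → ℝ
  | A, [] => if A = ∅ then 1 else 0
  | A, a :: l => if a ∈ A then D a / (∑ b ∈ A, D b) * drawProb D (A.erase a) l else 0

/-- The expectation of `X` when the preference list is drawn from the popularities `D` on the set
`A` of acceptable men. -/
noncomputable def popExpect [Fintype M] (D : M → ℝ) (A : Finset M) (X : PrefList M → ℝ) : ℝ :=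
  ∑ p : PrefList M, drawProb D A p.1 * X p

theorem drawProb_nonneg {D : M → ℝ} (l : List M) {A : Finset M} (hD : ∀ m ∈ A, 0 < D m) :
    0 ≤ drawProb D A l := by
  induction l generalizing A with
  | nil => unfold drawProb; split_ifs <;> norm_num
  | cons a l ih =>
    unfold drawProb
    split_ifs with ha
    · have h1 := (hD a ha).le
      have h2 : 0 ≤ ∑ b ∈ A, D b := Finset.sum_nonneg fun b hb => (hD b hb).le
      have h3 := ih (A := A.erase a) fun m hm => hD m (Finset.mem_of_mem_erase hm)
      positivity
    · exact le_rfl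

/-- Only the orderings of `A` have non-zero probability. -/
theorem drawProb_support {D : M → ℝ} (l : List M) {A : Finset M} (h : drawProb D A l ≠ 0) :
    l.Nodup ∧ l.toFinset = A := by
  induction l generalizing A with
  | nil =>
    unfold drawProb at h
    split_ifs at h with hA
    · simp [hA]
    · exact absurd rfl h
  | cons a l ih =>
    unfold drawProb at h
    split_ifs at h with ha
    · obtain ⟨h1, h2⟩ := ih (right_ne_zero_of_mul h)
      refine ⟨List.nodup_cons.2 ⟨fun hal => ?_, h1⟩, ?_⟩
      · have : a ∈ A.erase a := h2 ▸ List.mem_toFinset.2 hal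
        simp at this
      · rw [List.toFinset_cons, h2, Finset.insert_erase ha]
    · exact absurd rfl h

/-- The probabilities of all preference lists sum to one. -/
theorem popExpect_one [Fintype M] {D : M → ℝ} (A : Finset M) (hD : ∀ m ∈ A, 0 < D m) :
    popExpect D A (fun _ => 1) = 1 := by
  have key : ∀ (S : Finset M), (∀ m ∈ S, 0 < D m) →
      ∑ l ∈ S.val.lists.toFinset, drawProb D S l = 1 := by
    intro S
    induction S using Finset.strongInduction with
    | H S ih =>
      intro hS
      rcases S.eq_empty_or_nonempty with rfl | hne
      · have : (∅ : Finset M).val.lists.toFinset = {[]} := by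
          ext l
          rw [Multiset.mem_toFinset, Multiset.mem_lists_iff, Finset.empty_val, Finset.mem_singleton]
          exact eq_comm.trans (Multiset.coe_eq_zero l)
        rw [this]; simp [drawProb]
      · have hpos : 0 < ∑ b ∈ S, D b := Finset.sum_pos hS hne
        have hd : ∀ a ∈ S, ∑ l ∈ (S.erase a).val.lists.toFinset, drawProb D S (a :: l)
            = D a / ∑ b ∈ S, D b := by
          intro a ha
          simp only [drawProb, ha, if_true]
          rw [← Finset.mul_sum, ih _ (Finset.erase_ssubset ha)
            (fun m hm => hS m (Finset.mem_of_mem_erase hm)), mul_one]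
        calc ∑ l ∈ S.val.lists.toFinset, drawProb D S l
            = ∑ x ∈ S.sigma (fun a => (S.erase a).val.lists.toFinset), drawProb D S (x.1 :: x.2) := by
              symm
              refine Finset.sum_bij (fun x _ => x.1 :: x.2) ?_ ?_ ?_ (fun _ _ => rfl)
              · rintro ⟨a, l⟩ hx
                simp only [Finset.mem_sigma, Multiset.mem_toFinset, Multiset.mem_lists_iff, Finset.erase_val] at hx ⊢
                have := Multiset.cons_erase (s := S.val) hx.1
                rw [← this, hx.2]; rfl
              · rintro ⟨a, l⟩ _ ⟨b, l'⟩ _ h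
                simp only [List.cons.injEq] at h
                obtain ⟨rfl, rfl⟩ := h
                rfl
              · intro l hl
                rw [Multiset.mem_toFinset, Multiset.mem_lists_iff] at hl
                cases l with
                | nil => exact absurd (Finset.val_eq_zero.1 hl) hne.ne_empty
                | cons a l =>
                  have hl' : S.val = a ::ₘ (l : Multiset M) := hl
                  refine ⟨⟨a, l⟩, ?_, rfl⟩
                  simp only [Finset.mem_sigma, Multiset.mem_toFinset, Multiset.mem_lists_iff, Finset.erase_val]
                  refine ⟨?_, ?_⟩
                  · rw [← Finset.mem_val, hl']; simp
                  · rw [hl']; simp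
          _ = ∑ a ∈ S, D a / ∑ b ∈ S, D b := by
              rw [Finset.sum_sigma]; exact Finset.sum_congr rfl hd
          _ = 1 := by rw [← Finset.sum_div, div_self hpos.ne']
  refine Eq.trans ?_ (key A hD)
  simp only [popExpect, mul_one]
  symm
  refine Finset.sum_bij_ne_zero (fun l _ h => ⟨l, (drawProb_support l h).1⟩) ?_ ?_ ?_ ?_
  · intros; exact Finset.mem_univ _
  · intro a _ _ b _ _ h; simpa using h
  · intro p _ h
    refine ⟨p.1, ?_, h, rfl⟩
    rw [Multiset.mem_toFinset, Multiset.mem_lists_iff, ← (drawProb_support p.1 h).2, List.toFinset_val, p.2.dedup]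
    rfl
  · intros; rfl

end Popularity

/-! The dependence on the random list is reduced to pure combinatorics of the set `A`. For a man `x`
who can be married to `w` when she accepts nobody else, let `μ x` be the stable matching of that
reduced instance which is best for all men and marries `x` to `w`, and let `C x` be the men of `A`
who like `w` at least as much as their wife in `μ x`. These sets do not depend on the ordering of
`A`. By `exists_competitors`, `x` is a stable husband for an ordering exactly when he comes first in
`C x`. Moreover `C x` lies in the set `X` of all such men, and `y ∉ C x` forces `C x ⊆ C y`. The
proof rests on joins of stable matchings and on the rural hospitals theorem.

The best stable husband is the man of `X` drawn first. The worst is the successful man `h` with the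
smallest set `C h`; that `h` is this man depends only on the order inside `C h`. A man `y ∉ C h` has
`C h ⊆ C y`, so independently of that order he succeeds with probability D(y)/D(C y)
(`listExpect_filter_mul_find`), where D(S) is the total popularity of S. All other successful men
lie outside `C h`. Given the worst husband `h`, the expected number of husbands is thus 1 + ∑
D(y)/D(C y) over `y ∈ X \ C h`. This sum is at most ln D(X) − ln D(h), by comparison with a
logarithm (`IsCompetition.sum_div_le_log`).

Finally ln D(X) minus the expected log-popularity of the best husband is the entropy of the first
draw from `X`, hence at most ln |X| ≤ ln |A| (`log_sum_le_listExpect_log`). Adding the two estimates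
gives the theorem. -/

/-! ### Preferences as integer scores -/

namespace PrefList

variable {α : Type*} [DecidableEq α]

/-- A numerical representation of the preferences: acceptable partners have positive scores,
remaining single scores zero, and unacceptable partners score `-1`. -/
def score (p : PrefList α) : Option α → ℤ
  | none => 0
  | some a => if a ∈ p.1 then (p.1.length : ℤ) - p.1.idxOf a else -1

@[simp]
theorem score_none (p : PrefList α) : p.score none = 0 := rfl

theorem score_pos {p : PrefList α} {a : α} (h : a ∈ p.1) : 0 < p.score (some a) := by
  have := List.idxOf_lt_length_iff.2 h
  simp only [score, h, if_true]
  omega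

theorem score_neg {p : PrefList α} {a : α} (h : a ∉ p.1) : p.score (some a) = -1 := by
  simp [score, h]

theorem score_nonneg_iff {p : PrefList α} {a : α} : 0 ≤ p.score (some a) ↔ a ∈ p.1 := by
  by_cases h : a ∈ p.1
  · simp [h, (score_pos h).le]
  · simp [h, score_neg h]

theorem score_some_pos_iff {p : PrefList α} {a : α} : 0 < p.score (some a) ↔ a ∈ p.1 := by
  by_cases h : a ∈ p.1
  · simp [h, score_pos h]
  · simp [h, score_neg h]

theorem score_lt_iff_idxOf {p : PrefList α} {a b : α} (ha : a ∈ p.1) (hb : b ∈ p.1) :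
    p.score (some b) < p.score (some a) ↔ p.1.idxOf a < p.1.idxOf b := by
  simp only [score, ha, hb, if_true]
  omega

theorem prefers_iff_score_lt (p : PrefList α) (x y : Option α) :
    p.Prefers x y ↔ p.score y < p.score x := by
  rcases x with _ | a <;> rcases y with _ | b
  · simp [Prefers]
  · by_cases hb : b ∈ p.1
    · have := score_pos hb
      simp [Prefers, hb, this.le]
    · simp [Prefers, hb, score_neg hb]
  · by_cases ha : a ∈ p.1
    · have := score_pos ha
      simp [Prefers, ha, this]
    · simp [Prefers, ha, score_neg ha]
  · by_cases ha : a ∈ p.1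
    · by_cases hb : b ∈ p.1
      · simp [Prefers, ha, hb, score_lt_iff_idxOf]
      · have := score_pos ha
        simp only [Prefers, ha, hb, score_neg hb, true_and, false_imp_iff, true_iff]
        omega
    · by_cases hb : b ∈ p.1
      · have := score_pos hb
        simp only [Prefers, ha, score_neg ha, false_and, false_iff]
        omega
      · simp [Prefers, ha, score_neg ha, score_neg hb]

/-- Strictness of preferences. Nonnegativity is needed because all unacceptable partners share the
score −1. -/
theorem eq_of_score_eq {p : PrefList α} {x y : Option α} (h : p.score x = p.score y)
    (hx : 0 ≤ p.score x) : x = y := by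
  rcases x with _ | a <;> rcases y with _ | b
  · rfl
  · have := score_pos (score_nonneg_iff.1 (h ▸ hx))
    simp at h; omega
  · have := score_pos (score_nonneg_iff.1 hx)
    simp at h; omega
  · have ha := score_nonneg_iff.1 hx
    have hb := score_nonneg_iff.1 (h ▸ hx)
    simp only [score, ha, hb, if_true] at h
    have h' : p.1.idxOf a = p.1.idxOf b := by omega
    rw [(List.idxOf_inj ha).1 h']

theorem mem_acceptable {p : PrefList α} {a : α} : a ∈ p.acceptable ↔ a ∈ p.1 := by
  simp [acceptable]

end PrefList

/-! ### Matchings and the existence of stable ones -/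

namespace Matching

variable {M W : Type*}

theorem ext_wife {μ ν : Matching M W} (h : μ.wife = ν.wife) : μ = ν := by
  have h' : μ.husband = ν.husband := by
    funext w
    ext m
    rw [← μ.consistent, ← ν.consistent, h]
  cases μ; cases ν; simp_all

instance [Finite M] [Finite W] : Finite (Matching M W) :=
  Finite.of_injective Matching.wife fun _ _ h => ext_wife h

/-- The matching given by a partial injection of the men into the women. -/
noncomputable def ofWife (f : M → Option W)
    (hf : ∀ m m' w, f m = some w → f m' = some w → m = m') : Matching M W where
  wife := f
  husband w := open Classical in if h : ∃ m, f m = some w then some h.choose else none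
  consistent m w := by
    constructor
    · intro h
      have h' : ∃ m, f m = some w := ⟨m, h⟩
      simp only [h', dif_pos, Option.some.injEq]
      exact hf _ _ _ h'.choose_spec h
    · intro h
      split_ifs at h with h'
      simp only [Option.some.injEq] at h
      exact h ▸ h'.choose_spec

/-- Turns a statement about how many men are matched into one about women; used for the rural
hospitals theorem. -/
theorem card_matched [Fintype M] [Fintype W] [DecidableEq M] [DecidableEq W] (μ : Matching M W) :
    (Finset.univ.filter fun m => μ.wife m ≠ none).card =
      (Finset.univ.filter fun w => μ.husband w ≠ none).card := by
  refine Finset.card_bij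
    (fun m hm => (μ.wife m).get (Option.isSome_iff_ne_none.2 (Finset.mem_filter.1 hm).2)) ?_ ?_ ?_
  · intro m hm
    have : μ.husband ((μ.wife m).get (Option.isSome_iff_ne_none.2 (Finset.mem_filter.1 hm).2))
      = some m := by
        rw [← μ.consistent]; simp
    simp [this]
  · intro m hm m' hm' h
    have h1 := (μ.consistent m _).1 (Option.some_get
      (Option.isSome_iff_ne_none.2 (Finset.mem_filter.1 hm).2)).symm
    have h2 := (μ.consistent m' _).1 (Option.some_get
      (Option.isSome_iff_ne_none.2 (Finset.mem_filter.1 hm').2)).symm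
    rw [h, h2] at h1
    exact (Option.some.inj h1).symm
  · intro w hw
    obtain ⟨m, hm⟩ := Option.ne_none_iff_exists'.1 (Finset.mem_filter.1 hw).2
    have h := (μ.consistent m w).2 hm
    exact ⟨m, by simp [h], by simp [h]⟩

variable [DecidableEq M] [DecidableEq W]

theorem isStable_iff {μ : Matching M W} {pM : M → PrefList W} {pW : W → PrefList M} :
    μ.IsStable pM pW ↔ (∀ m, 0 ≤ (pM m).score (μ.wife m)) ∧
      (∀ w, 0 ≤ (pW w).score (μ.husband w)) ∧
      ∀ m w, (pW w).score (μ.husband w) < (pW w).score (some m) →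
        (pM m).score (some w) ≤ (pM m).score (μ.wife m) := by
  simp only [IsStable, PrefList.prefers_iff_score_lt, PrefList.score_none, not_lt, not_and]

/-- Marry `m` and `w`, whose previous partners become single. -/
def marry (μ : Matching M W) (m : M) (w : W) : Matching M W where
  wife m' := if m' = m then some w else if μ.wife m' = some w then none else μ.wife m'
  husband w' := if w' = w then some m else if μ.husband w' = some m then none else μ.husband w'
  consistent m' w' := by
    have h1 := μ.consistent m' w'
    have h2 := μ.consistent m' w
    have h3 := μ.consistent m w'
    grind

/-- **Gale–Shapley**: a stable matching exists. -/
theorem exists_isStable [Finite M] [Finite W] (pM : M → PrefList W) (pW : W → PrefList M) :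
    ∃ μ : Matching M W, μ.IsStable pM pW := by
  have := Fintype.ofFinite M
  have := Fintype.ofFinite W
  -- Relaxed stability: only single men may take part in blocking pairs. The empty matching
  -- qualifies, and a member with the largest total score for the women turns out to be stable.
  let S : Set (Matching M W) := {μ | (∀ m, 0 ≤ (pM m).score (μ.wife m)) ∧
      (∀ w, 0 ≤ (pW w).score (μ.husband w)) ∧
      ∀ m w, (pW w).score (μ.husband w) < (pW w).score (some m) →
        (pM m).score (μ.wife m) < (pM m).score (some w) → μ.wife m = none}
  have hS : S.Nonempty := ⟨⟨fun _ => none, fun _ => none, by simp⟩, by simp [S]⟩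
  obtain ⟨μ, ⟨h1, h2, h3⟩, hmax⟩ :=
    S.exists_max_image (fun μ => ∑ w, (pW w).score (μ.husband w)) S.toFinite hS
  refine ⟨μ, isStable_iff.2 ⟨h1, h2, ?_⟩⟩
  by_contra hcon
  push Not at hcon
  obtain ⟨m, w₀, hw₀, hm₀⟩ := hcon
  -- Among the women who block with `m`, take his favourite: once they are married, `m` is in no
  -- blocking pair, and a divorced husband is single and so allowed to block.
  obtain ⟨w, hw, hwmax⟩ := (Finset.univ.filter fun w =>
    (pW w).score (μ.husband w) < (pW w).score (some m) ∧
      (pM m).score (μ.wife m) < (pM m).score (some w)).exists_max_image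
      (fun w => (pM m).score (some w)) ⟨w₀, by simp [hw₀, hm₀]⟩
  simp only [Finset.mem_filter, Finset.mem_univ, true_and, and_imp] at hw hwmax
  have hsingle := h3 m w hw.1 hw.2
  have hhus : ∀ w', (μ.marry m w).husband w' = if w' = w then some m else μ.husband w' := by
    intro w'
    have := μ.consistent m w'
    simp only [marry]
    grind
  have hmono : ∀ w', (pW w').score (μ.husband w') ≤ (pW w').score ((μ.marry m w).husband w') := by
    intro w'
    rw [hhus]
    split_ifs with h
    · subst h; exact hw.1.le
    · exact le_rfl
  have hlt : ∑ w', (pW w').score (μ.husband w') <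
      ∑ w', (pW w').score ((μ.marry m w).husband w') :=
    Finset.sum_lt_sum (fun w' _ => hmono w') ⟨w, Finset.mem_univ _, by simpa [hhus] using hw.1⟩
  refine absurd (hmax (μ.marry m w) ⟨?_, fun w' => (h2 w').trans (hmono w'), ?_⟩) (not_le.2 hlt)
  · intro m'
    simp only [marry]
    split_ifs with h h'
    · subst h; exact (h1 m').trans hw.2.le
    · simp
    · exact h1 m'
  · intro m' w' hb hb'
    have hb1 := (hmono w').trans_lt hb
    simp only [marry] at hb' ⊢
    split_ifs at hb' ⊢ with h h'
    · subst h
      exact absurd (hwmax w' hb1 (hw.2.trans hb')) (not_le.2 hb')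
    · rfl
    · exact h3 m' w' hb1 hb'

/-! ### Joins of stable matchings and the rural hospitals theorem -/

section Join

variable {pM : M → PrefList W} {pW : W → PrefList M} {μ ν : Matching M W}

/-- If `m` is married to `w` in `μ` but strictly prefers `w` to his wife in `ν`, then `w` strictly
prefers her husband in `ν`. -/
theorem IsStable.score_lt (hμ : μ.IsStable pM pW) (hν : ν.IsStable pM pW) {m : M} {w : W}
    (hm : μ.wife m = some w) (h : (pM m).score (ν.wife m) < (pM m).score (some w)) :
    (pW w).score (some m) < (pW w).score (ν.husband w) := by
  have h0 : 0 ≤ (pW w).score (some m) := (μ.consistent m w).1 hm ▸ (isStable_iff.1 hμ).2.1 w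
  refine lt_of_le_of_ne (not_lt.1 fun h' => ?_) fun h' => ?_
  · exact absurd ((isStable_iff.1 hν).2.2 m w h') (not_le.2 h)
  · have := (ν.consistent m w).2 (PrefList.eq_of_score_eq h' h0).symm
    rw [this] at h
    exact lt_irrefl _ h

/-- The wives when every man takes the better of his two wives. -/
def joinWife (pM : M → PrefList W) (μ ν : Matching M W) (m : M) : Option W :=
  if (pM m).score (μ.wife m) < (pM m).score (ν.wife m) then ν.wife m else μ.wife m

theorem joinWife_cases (hμ : μ.IsStable pM pW) {m : M} {w : W}
    (h : joinWife pM μ ν m = some w) :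
    (μ.wife m = some w ∧ (ν.wife m = some w ∨ (pM m).score (ν.wife m) < (pM m).score (some w))) ∨
    (ν.wife m = some w ∧ (pM m).score (μ.wife m) < (pM m).score (some w)) := by
  unfold joinWife at h
  split_ifs at h with hlt
  · exact Or.inr ⟨h, h ▸ hlt⟩
  · refine Or.inl ⟨h, ?_⟩
    rcases (not_lt.1 hlt).lt_or_eq with h' | h'
    · exact Or.inr (h ▸ h')
    · exact Or.inl ((PrefList.eq_of_score_eq h'.symm ((isStable_iff.1 hμ).1 m)).symm.trans h)

/-- The join of two stable matchings: every man takes the better of his two wives. -/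
noncomputable def join (hμ : μ.IsStable pM pW) (hν : ν.IsStable pM pW) : Matching M W :=
  ofWife (joinWife pM μ ν) (by
    intro m m' w h h'
    -- If distinct men took `w` from the two different matchings, `w` would strictly prefer each of
    -- them to the other.
    have key : ∀ {μ ν : Matching M W}, μ.IsStable pM pW → ν.IsStable pM pW → ∀ {m m'},
        μ.wife m = some w → ν.wife m' = some w →
        (ν.wife m = some w ∨ (pM m).score (ν.wife m) < (pM m).score (some w)) →
        (pM m').score (μ.wife m') < (pM m').score (some w) → m = m' := by
      intro μ ν hμ hν m m' h1 h2 h3 h4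
      rcases h3 with h3 | h3
      · rw [ν.consistent] at h2 h3
        exact Option.some.inj (h3.symm.trans h2)
      · have h5 := hμ.score_lt hν h1 h3
        have h6 := hν.score_lt hμ h2 h4
        rw [μ.consistent] at h1
        rw [ν.consistent] at h2
        rw [h2] at h5
        rw [h1] at h6
        exact absurd h5 h6.asymm
    rcases joinWife_cases hμ h with ⟨h1, h2⟩ | ⟨h1, h2⟩ <;>
      rcases joinWife_cases hμ h' with ⟨h3, h4⟩ | ⟨h3, h4⟩
    · rw [μ.consistent] at h1 h3
      exact Option.some.inj (h1.symm.trans h3)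
    · exact key hμ hν h1 h3 h2 h4
    · exact (key hμ hν h3 h1 h4 h2).symm
    · rw [ν.consistent] at h1 h3
      exact Option.some.inj (h1.symm.trans h3))

theorem join_wife (hμ : μ.IsStable pM pW) (hν : ν.IsStable pM pW) (m : M) :
    (join hμ hν).wife m = joinWife pM μ ν m := rfl

theorem le_join_left (hμ : μ.IsStable pM pW) (hν : ν.IsStable pM pW) (m : M) :
    (pM m).score (μ.wife m) ≤ (pM m).score ((join hμ hν).wife m) := by
  rw [join_wife, joinWife]; split_ifs with h
  · exact h.le
  · exact le_rfl

theorem le_join_right (hμ : μ.IsStable pM pW) (hν : ν.IsStable pM pW) (m : M) :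
    (pM m).score (ν.wife m) ≤ (pM m).score ((join hμ hν).wife m) := by
  rw [join_wife, joinWife]; split_ifs with h
  · exact le_rfl
  · exact not_lt.1 h

theorem join_husband_eq (hμ : μ.IsStable pM pW) (hν : ν.IsStable pM pW) {w : W} {m : M}
    (h : (join hμ hν).husband w = some m) : μ.husband w = some m ∨ ν.husband w = some m := by
  rw [← Matching.consistent, join_wife] at h
  rcases joinWife_cases hμ h with h | h
  · exact Or.inl ((μ.consistent _ _).1 h.1)
  · exact Or.inr ((ν.consistent _ _).1 h.1)

/-- A man who takes `w` from one matching either has her in the other too, or strictly prefers her;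
then she strictly prefers her other husband to him, so she has one. -/
theorem ne_none_of_join (hμ : μ.IsStable pM pW) (hν : ν.IsStable pM pW) {w : W}
    (h : (join hμ hν).husband w ≠ none) : μ.husband w ≠ none ∧ ν.husband w ≠ none := by
  have key : ∀ {μ ν : Matching M W}, μ.IsStable pM pW → ν.IsStable pM pW → ∀ {m},
      μ.wife m = some w → (pM m).score (ν.wife m) < (pM m).score (some w) →
      ν.husband w ≠ none := by
    intro μ ν hμ hν m h1 h2 h3
    have h4 := hμ.score_lt hν h1 h2
    have h5 := (isStable_iff.1 hμ).2.1 w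
    rw [(μ.consistent _ _).1 h1] at h5
    rw [h3, PrefList.score_none] at h4
    omega
  obtain ⟨m, hm⟩ := Option.ne_none_iff_exists'.1 h
  rw [← Matching.consistent, join_wife] at hm
  rcases joinWife_cases hμ hm with ⟨h1, h2⟩ | ⟨h1, h2⟩
  · refine ⟨by simp [(μ.consistent _ _).1 h1], ?_⟩
    rcases h2 with h2 | h2
    · simp [(ν.consistent _ _).1 h2]
    · exact key hμ hν h1 h2
  · exact ⟨key hν hμ h1 h2, by simp [(ν.consistent _ _).1 h1]⟩

theorem join_husband_eq_none_iff [Finite M] [Finite W] (hμ : μ.IsStable pM pW)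
    (hν : ν.IsStable pM pW) (w : W) : (join hμ hν).husband w = none ↔ μ.husband w = none := by
  have := Fintype.ofFinite M
  have := Fintype.ofFinite W
  have hsub : (Finset.univ.filter fun w => (join hμ hν).husband w ≠ none) ⊆
      Finset.univ.filter fun w => μ.husband w ≠ none := by
    intro w hw
    simp only [Finset.mem_filter, Finset.mem_univ, true_and] at hw ⊢
    exact (ne_none_of_join hμ hν hw).1
  have hcard : (Finset.univ.filter fun w => μ.husband w ≠ none).card ≤
      (Finset.univ.filter fun w => (join hμ hν).husband w ≠ none).card := by
    -- No man loses in the join, so at least as many men are matched as in `μ`, and the same holds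
    -- for the women.
    rw [← card_matched, ← card_matched]
    refine Finset.card_le_card fun m hm => ?_
    simp only [Finset.mem_filter, Finset.mem_univ, true_and] at hm ⊢
    obtain ⟨w', hw'⟩ := Option.ne_none_iff_exists'.1 hm
    have h1 := (isStable_iff.1 hμ).1 m
    have h2 := le_join_left hμ hν m
    intro h
    rw [hw'] at h1 h2
    have := PrefList.score_pos (PrefList.score_nonneg_iff.1 h1)
    rw [h, PrefList.score_none] at h2
    omega
  have := Finset.ext_iff.1 (Finset.eq_of_subset_of_card_le hsub hcard) w
  simp only [Finset.mem_filter, Finset.mem_univ, true_and] at this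
  exact not_iff_not.1 this

/-- **Rural hospitals theorem** for the women. -/
theorem IsStable.husband_eq_none_iff [Finite M] [Finite W] (hμ : μ.IsStable pM pW)
    (hν : ν.IsStable pM pW) (w : W) : μ.husband w = none ↔ ν.husband w = none := by
  have key : ∀ {μ ν : Matching M W}, μ.IsStable pM pW → ν.IsStable pM pW →
      ν.husband w = none → μ.husband w = none := fun hμ hν h => by
    by_contra h'
    rw [← join_husband_eq_none_iff hμ hν] at h'
    exact (ne_none_of_join hμ hν h').2 h
  exact ⟨key hν hμ, key hμ hν⟩

/-- A pair blocking the join would block whichever of `μ`, `ν` gives `w` the same situation, since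
the man is no better off there. -/
theorem join_isStable [Finite M] [Finite W] (hμ : μ.IsStable pM pW) (hν : ν.IsStable pM pW) :
    (join hμ hν).IsStable pM pW := by
  have hhus : ∀ w, (join hμ hν).husband w = μ.husband w ∨
      (join hμ hν).husband w = ν.husband w := by
    intro w
    rcases h : (join hμ hν).husband w with _ | m
    · exact Or.inl ((join_husband_eq_none_iff hμ hν w).1 h).symm
    · exact (join_husband_eq hμ hν h).imp Eq.symm Eq.symm
  rw [isStable_iff] at *
  refine ⟨fun m => (hμ.1 m).trans (le_join_left _ _ m), fun w => ?_, fun m w h => ?_⟩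
  · rcases hhus w with h | h <;> rw [h]
    exacts [hμ.2.1 w, hν.2.1 w]
  · rcases hhus w with h' | h' <;> rw [h'] at h
    · exact (hμ.2.2 m w h).trans (le_join_left _ _ m)
    · exact (hν.2.2 m w h).trans (le_join_right _ _ m)

end Join

end Matching

/-! ### Lists with one or two acceptable partners -/

namespace PrefList

variable {α : Type*} [DecidableEq α]

/-- The list with a single acceptable partner. -/
def single (x : α) : PrefList α := ⟨[x], List.nodup_singleton x⟩

/-- The list with two acceptable partners, the better one first. -/
def pair {x y : α} (h : x ≠ y) : PrefList α := ⟨[x, y], by simpa using h⟩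

@[simp]
theorem score_single_self (x : α) : (single x).score (some x) = 1 := by simp [score, single]

theorem eq_of_score_single {x : α} {a : Option α} (h : 0 < (single x).score a) : a = some x := by
  rcases a with _ | a
  · simp at h
  · rw [score_some_pos_iff] at h
    simp only [single, List.mem_singleton] at h
    rw [h]

theorem score_single_le (x : α) (a : Option α) : (single x).score a ≤ 1 := by
  by_contra h
  rw [eq_of_score_single (a := a) (x := x) (by omega)] at h
  simp at h

@[simp]
theorem score_pair_left {x y : α} (h : x ≠ y) : (pair h).score (some x) = 2 := by
  simp [score, pair]

@[simp]
theorem score_pair_right {x y : α} (h : x ≠ y) : (pair h).score (some y) = 1 := by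
  simp [score, pair, h]

theorem eq_of_score_pair {x y : α} (h : x ≠ y) {a : Option α} (ha : 0 < (pair h).score a) :
    a = some x ∨ a = some y := by
  rcases a with _ | a
  · simp at ha
  · rw [score_some_pos_iff] at ha
    simpa [pair] using ha

theorem score_pair_le {x y : α} (h : x ≠ y) (a : Option α) : (pair h).score a ≤ 2 := by
  by_contra h'
  rcases eq_of_score_pair h (a := a) (by omega) with rfl | rfl <;> simp at h'

end PrefList

/-! ### Stable husbands of one woman as her list varies -/

section Husbands

variable {M W : Type*} [DecidableEq M] [DecidableEq W]
variable {pM : M → PrefList W} {pW : W → PrefList M} {w : W}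

open PrefList

namespace Matching

theorem isStable_update_iff {q : PrefList M} {μ : Matching M W} :
    μ.IsStable pM (Function.update pW w q) ↔ (∀ m, 0 ≤ (pM m).score (μ.wife m)) ∧
      (∀ v, v ≠ w → 0 ≤ (pW v).score (μ.husband v) ∧
        ∀ m, (pW v).score (μ.husband v) < (pW v).score (some m) →
          (pM m).score (some v) ≤ (pM m).score (μ.wife m)) ∧
      0 ≤ q.score (μ.husband w) ∧ ∀ m, q.score (μ.husband w) < q.score (some m) →
          (pM m).score (some w) ≤ (pM m).score (μ.wife m) := by
  rw [isStable_iff]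
  constructor
  · rintro ⟨h1, h2, h3⟩
    refine ⟨h1, fun v hv => ⟨?_, fun m => ?_⟩, ?_, fun m => ?_⟩
    · simpa [hv] using h2 v
    · simpa [hv] using h3 m v
    · simpa using h2 w
    · simpa using h3 m w
  · rintro ⟨h1, h2, h3, h4⟩
    refine ⟨h1, fun v => ?_, fun m v => ?_⟩ <;> by_cases hv : v = w
    · subst hv; simpa using h3
    · simpa [hv] using (h2 v hv).1
    · subst hv; simpa using h4 m
    · simpa [hv] using (h2 v hv).2 m

/-- Stability is preserved under a change of the preferences of `w` that keeps her husband
acceptable and creates no blocking pair. -/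
theorem IsStable.change {p : PrefList M} (q : PrefList M) {μ : Matching M W}
    (hμ : μ.IsStable pM (Function.update pW w p)) (h : 0 ≤ q.score (μ.husband w))
    (h' : ∀ m, q.score (μ.husband w) < q.score (some m) →
      (pM m).score (some w) ≤ (pM m).score (μ.wife m)) :
    μ.IsStable pM (Function.update pW w q) := by
  rw [isStable_update_iff] at hμ ⊢
  exact ⟨hμ.1, hμ.2.1, h, h'⟩

/-- `μ` is stable when `x` is the only man acceptable to `w`, and it matches `x` with `w`. -/
def IsStableFor (pM : M → PrefList W) (pW : W → PrefList M) (w : W) (x : M)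
    (μ : Matching M W) : Prop :=
  μ.IsStable pM (Function.update pW w (single x)) ∧ μ.husband w = some x

/-- Striking everybody but her husband off the list of `w` leaves no man who could block with her.
This leads from any ordering to an instance independent of it. -/
theorem IsStable.isStableFor {p : PrefList M} {μ : Matching M W} {x : M}
    (hμ : μ.IsStable pM (Function.update pW w p)) (hx : μ.husband w = some x) :
    μ.IsStableFor pM pW w x := by
  refine ⟨hμ.change _ ?_ fun m h => ?_, hx⟩
  · simp [hx]
  · have := score_single_le x (some m)
    rw [hx, score_single_self] at h
    omega

/-- `μ` is the best for the men among the matchings stable for `x`. -/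
def IsOptimalFor (pM : M → PrefList W) (pW : W → PrefList M) (w : W) (x : M)
    (μ : Matching M W) : Prop :=
  μ.IsStableFor pM pW w x ∧
    ∀ ν : Matching M W, ν.IsStableFor pM pW w x → ∀ m, (pM m).score (ν.wife m) ≤
      (pM m).score (μ.wife m)

theorem join_husband_of_eq {μ ν : Matching M W} [Finite M] [Finite W] {pW : W → PrefList M}
    (hμ : μ.IsStable pM pW) (hν : ν.IsStable pM pW) {x : M} (h : μ.husband w = some x)
    (h' : ∀ y, ν.husband w = some y → (join hμ hν).husband w = some y → y = x) :
    (join hμ hν).husband w = some x := by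
  have hJ := (join_husband_eq_none_iff hμ hν w).not.2 (by simp [h])
  obtain ⟨y, hy⟩ := Option.ne_none_iff_exists'.1 hJ
  rcases join_husband_eq hμ hν hy with h1 | h1
  · rw [hy, ← h1, h]
  · rw [hy, h' y h1 hy]

/-- Matchings stable for `x` are closed under joins, so one that maximises the total score of the
men is best for each man. -/
theorem exists_isOptimalFor [Finite M] [Finite W] {x : M}
    (h : ∃ μ : Matching M W, μ.IsStableFor pM pW w x) :
    ∃ μ : Matching M W, μ.IsOptimalFor pM pW w x := by
  have := Fintype.ofFinite M
  obtain ⟨μ, hμ, hmax⟩ := Set.exists_max_image {μ : Matching M W | μ.IsStableFor pM pW w x}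
    (fun μ => ∑ m, (pM m).score (μ.wife m)) (Set.toFinite _) h
  refine ⟨μ, hμ, fun ν hν m => ?_⟩
  have hJ : (join hμ.1 hν.1).IsStableFor pM pW w x :=
    ⟨join_isStable _ _, join_husband_of_eq hμ.1 hν.1 hμ.2 fun y hy _ => by
      have := hν.2; rw [hy] at this; exact Option.some.inj this⟩
  have h1 := hmax _ hJ
  by_contra hlt
  exact absurd h1 (not_le.2 (Finset.sum_lt_sum (fun m _ => le_join_left hμ.1 hν.1 m)
    ⟨m, Finset.mem_univ m, (not_le.1 hlt).trans_le (le_join_right hμ.1 hν.1 m)⟩))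

/-- The men of `A` who weakly prefer `w` to their wife in `μ`. -/
def wooers (pM : M → PrefList W) (w : W) (A : Finset M) (μ : Matching M W) : Finset M :=
  A.filter fun m => (pM m).score (μ.wife m) ≤ (pM m).score (some w)

omit [DecidableEq M] in
theorem mem_wooers {A : Finset M} {μ : Matching M W} {m : M} :
    m ∈ μ.wooers pM w A ↔ m ∈ A ∧ (pM m).score (μ.wife m) ≤ (pM m).score (some w) := by
  simp [wooers]

/-- The husband of `w` in a stable matching is the first of the men who woo her. -/
theorem IsStable.first_wooer {A : Finset M} {p : PrefList M} (hp : p.acceptable = A)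
    {μ : Matching M W} (hμ : μ.IsStable pM (Function.update pW w p)) {x : M}
    (hx : μ.husband w = some x) {y : M} (hy : y ∈ μ.wooers pM w A) (hyx : y ≠ x) :
    p.1.idxOf x < p.1.idxOf y := by
  rw [mem_wooers, ← hp, mem_acceptable] at hy
  rw [isStable_update_iff, hx, score_nonneg_iff] at hμ
  rw [← score_lt_iff_idxOf hμ.2.2.1 hy.1]
  refine lt_of_le_of_ne (not_lt.1 fun h => ?_) fun h => ?_
  · have h1 := le_antisymm hy.2 (hμ.2.2.2 y h)
    have h2 := (μ.consistent y w).1 (eq_of_score_eq h1 (hμ.1 y))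
    rw [hx] at h2
    exact hyx (Option.some.inj h2).symm
  · exact hyx (Option.some.inj (eq_of_score_eq h (score_nonneg_iff.2 hy.1)))

/-- If `x` is the first of the wooers in a matching stable for `x`, then it is stable. -/
theorem IsStableFor.isStable {A : Finset M} {p : PrefList M} (hp : p.acceptable = A)
    {μ : Matching M W} {x : M} (hμ : μ.IsStableFor pM pW w x) (hxA : x ∈ A)
    (h : ∀ y ∈ μ.wooers pM w A, y ≠ x → p.1.idxOf x < p.1.idxOf y) :
    μ.IsStable pM (Function.update pW w p) := by
  rw [← hp, mem_acceptable] at hxA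
  refine hμ.1.change p ?_ fun m hm => ?_
  · rw [hμ.2, score_nonneg_iff]; exact hxA
  · by_contra hlt
    rw [hμ.2] at hm
    have hmp : m ∈ p.1 := score_some_pos_iff.1 ((score_pos hxA).trans hm)
    have hmx : m ≠ x := fun h => by subst h; exact lt_irrefl _ hm
    have := h m (mem_wooers.2 ⟨by rwa [← hp, mem_acceptable], (not_le.1 hlt).le⟩) hmx
    rw [← score_lt_iff_idxOf hxA hmp] at this
    exact absurd hm this.asymm

theorem IsStableFor.mem_wooers {A : Finset M} {μ : Matching M W} {x : M}
    (hμ : μ.IsStableFor pM pW w x) (hxA : x ∈ A) : x ∈ μ.wooers pM w A :=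
  Matching.mem_wooers.2 ⟨hxA, by rw [(μ.consistent x w).2 hμ.2]⟩

variable {A : Finset M}

/-- A man who woos `w` in a matching that is optimal for `x` can be married to her himself. -/
theorem IsOptimalFor.exists_isStableFor [Finite M] [Finite W] {μ : Matching M W} {x z : M}
    (hμ : μ.IsOptimalFor pM pW w x) (hz : z ∈ μ.wooers pM w A) :
    ∃ ν : Matching M W, ν.IsStableFor pM pW w z := by
  rcases eq_or_ne z x with rfl | hzx
  · exact ⟨μ, hμ.1⟩
  -- Test instance in which `w` accepts only `z` and `x`, with `z` first; it remains to exclude that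
  -- she ends up single or with `x`.
  obtain ⟨ν, hν⟩ := exists_isStable pM (Function.update pW w (pair hzx))
  have hν' := isStable_update_iff.1 hν
  have hpos : ν.husband w ≠ some z →
      (pM z).score (some w) < (pM z).score (ν.wife z) := by
    intro hne
    refine lt_of_le_of_ne (hν'.2.2.2 z ?_) fun h => ?_
    · refine lt_of_le_of_ne ?_ fun h => ?_
      · rw [score_pair_left]; exact score_pair_le _ _
      · exact hne (eq_of_score_eq h hν'.2.2.1)
    · exact hne ((ν.consistent z w).1 (eq_of_score_eq h.symm (hν'.1 z)))
  rcases h : ν.husband w with _ | y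
  · exfalso
    -- If `w` were single, `ν` would also be stable when she accepts only `x`, where `μ` marries
    -- her: this contradicts the rural hospitals theorem.
    have h1 := hν.change (single x) (by simp [h]) fun m hm => by
      rw [h, score_none] at hm
      obtain rfl := Option.some.inj (eq_of_score_single hm)
      refine hν'.2.2.2 _ ?_
      rw [h]; simp
    have := (h1.husband_eq_none_iff hμ.1.1 w).1 h
    rw [hμ.1.2] at this
    cases this
  · have hy := score_nonneg_iff.1 (h ▸ hν'.2.2.1)
    simp only [pair, List.mem_cons, List.not_mem_nil, or_false] at hy
    rcases hy with rfl | rfl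
    · exact ⟨ν, hν.isStableFor h⟩
    · exfalso
      -- If she got `x`, then `z` would prefer his wife in `ν` to `w`, hence by optimality also his
      -- wife in `μ`, and would not woo her.
      have h1 := hμ.2 ν (hν.isStableFor h) z
      have h2 := hpos (by rw [h]; simpa using hzx.symm)
      have h3 := (Matching.mem_wooers.1 hz).2
      omega

/-- A man `y` who does not woo `w` in the matching optimal for `x` comes after `x` in the sequence
of the possible husbands of `w`. -/
theorem IsOptimalFor.wooers_subset [Finite M] [Finite W] {μ ν : Matching M W} {x y : M}
    (hμ : μ.IsOptimalFor pM pW w x) (hν : ν.IsStableFor pM pW w y) (hx : x ∈ A) (hyA : y ∈ A)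
    (hy : y ∉ μ.wooers pM w A) :
    μ.wooers pM w A ⊆ ν.wooers pM w A ∧ x ∈ ν.wooers pM w A := by
  have hyx : y ≠ x := fun h => hy (h ▸ hμ.1.mem_wooers hx)
  have hyμ : (pM y).score (some w) < (pM y).score (μ.wife y) :=
    not_le.1 fun h => hy (Matching.mem_wooers.2 ⟨hyA, h⟩)
  -- Both matchings are stable when `w` accepts `y` first and `x` second: in `μ` the man `y` has a
  -- wife he prefers to `w`, and in `ν` she has her favourite.
  have hμ' : μ.IsStable pM (Function.update pW w (pair hyx)) := by
    refine hμ.1.1.change _ (by simp [hμ.1.2]) fun m hm => ?_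
    rw [hμ.1.2, score_pair_right] at hm
    rcases eq_of_score_pair hyx (a := some m) (by omega) with h | h
    · rw [Option.some.inj h]; exact hyμ.le
    · rw [h, score_pair_right] at hm; omega
  have hν' : ν.IsStable pM (Function.update pW w (pair hyx)) := by
    refine hν.1.change _ (by simp [hν.2]) fun m hm => ?_
    have := score_pair_le hyx (some m)
    rw [hν.2, score_pair_left] at hm
    omega
  -- In the join `w` cannot get `y`, who does better in `μ`. The join is therefore stable for `x`,
  -- so optimality of `μ` makes every man at least as happy in `μ` as in `ν`.
  have hJx : (join hμ' hν').husband w = some x := by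
    refine join_husband_of_eq hμ' hν' hμ.1.2 fun z hz hJ => ?_
    rw [hν.2] at hz
    obtain rfl := Option.some.inj hz
    have h1 := le_join_left hμ' hν' y
    rw [((join hμ' hν').consistent _ _).2 hJ] at h1
    omega
  have hJ := (join_isStable hμ' hν').isStableFor hJx
  have hsub : μ.wooers pM w A ⊆ ν.wooers pM w A := by
    intro m hm
    rw [Matching.mem_wooers] at hm ⊢
    refine ⟨hm.1, ?_⟩
    by_contra hlt
    have h1 := le_join_right hμ' hν' m
    have h2 : (pM m).score ((join hμ' hν').wife m) ≤ (pM m).score (μ.wife m) := hμ.2 _ hJ m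
    omega
  exact ⟨hsub, hsub (hμ.1.mem_wooers hx)⟩

end Matching

/-- The structure of the stable husbands of `w` as a function of her ordering of `A`: there are a
set `X` of possible husbands and, for each `x ∈ X`, a set `C x` of competitors such that `x` is a
stable husband if and only if he is the first man of `C x`. -/
theorem exists_competitors [Finite M] [Finite W] (pM : M → PrefList W) (pW : W → PrefList M)
    (w : W) (A : Finset M) :
    ∃ (X : Finset M) (C : M → Finset M), X ⊆ A ∧ (∀ x ∈ X, x ∈ C x ∧ C x ⊆ X) ∧
      (∀ x ∈ X, ∀ y ∈ X, y ∉ C x → C x ⊆ C y ∧ x ∈ C y) ∧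
      ∀ p : PrefList M, p.acceptable = A → ∀ x,
        IsStableHusband pM (Function.update pW w p) w x ↔
          x ∈ X ∧ ∀ y ∈ C x, y ≠ x → p.1.idxOf x < p.1.idxOf y := by
  classical
  let X : Finset M := A.filter fun x => ∃ μ : Matching M W, μ.IsStableFor pM pW w x
  have hX : ∀ {x}, x ∈ X ↔ x ∈ A ∧ ∃ μ : Matching M W, μ.IsStableFor pM pW w x := by simp [X]
  -- Outside `X` the matching is an irrelevant default.
  have hex : ∀ x, ∃ μ : Matching M W, x ∈ X → μ.IsOptimalFor pM pW w x := by
    intro x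
    by_cases hx : x ∈ X
    · obtain ⟨μ, hμ⟩ := Matching.exists_isOptimalFor (hX.1 hx).2
      exact ⟨μ, fun _ => hμ⟩
    · obtain ⟨μ, -⟩ := Matching.exists_isStable pM pW
      exact ⟨μ, fun h => absurd h hx⟩
  choose μ hμ using hex
  refine ⟨X, fun x => (μ x).wooers pM w A, Finset.filter_subset _ _, fun x hx => ⟨?_, ?_⟩,
    fun x hx y hy h => ?_, fun p hp x => ⟨?_, ?_⟩⟩
  · exact (hμ x hx).1.mem_wooers (hX.1 hx).1
  · intro z hz
    exact hX.2 ⟨(Matching.mem_wooers.1 hz).1, (hμ x hx).exists_isStableFor hz⟩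
  · exact (hμ x hx).wooers_subset (hμ y hy).1 (hX.1 hx).1 (hX.1 hy).1 h
  · rintro ⟨ν, hν, hνx⟩
    have hν' := hν.isStableFor hνx
    have hxA : x ∈ A := by
      rw [← hp, mem_acceptable, ← score_nonneg_iff, ← hνx]
      exact (Matching.isStable_update_iff.1 hν).2.2.1
    have hxX : x ∈ X := hX.2 ⟨hxA, ν, hν'⟩
    refine ⟨hxX, fun y hy hyx => hν.first_wooer hp hνx ?_ hyx⟩
    -- The stable matching `ν` need not be `μ x`, but every man is at least as well off in `μ x`, so
    -- whoever woos `w` there woos her in `ν`.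
    rw [Matching.mem_wooers] at hy ⊢
    exact ⟨hy.1, ((hμ x hxX).2 ν hν' y).trans hy.2⟩
  · rintro ⟨hx, h⟩
    exact ⟨μ x, (hμ x hx).1.isStable hp (hX.1 hx).1 h, (hμ x hx).1.2⟩

end Husbands

/-! ### Drawing without replacement -/

section RandomOrder

variable {M : Type*} [DecidableEq M]

/-- The expectation of a function of the list drawn from the popularities `D` on `A`. -/
noncomputable def listExpect (D : M → ℝ) (A : Finset M) (f : List M → ℝ) : ℝ :=
  ∑ l ∈ A.val.lists.toFinset, drawProb D A l * f l

theorem mem_lists_toFinset {A : Finset M} {l : List M} :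
    l ∈ A.val.lists.toFinset ↔ l.Nodup ∧ l.toFinset = A := by
  rw [Multiset.mem_toFinset, Multiset.mem_lists_iff]
  constructor
  · intro h
    have hl : l.Nodup := by rw [← Multiset.coe_nodup, ← Multiset.quot_mk_to_coe, ← h]; exact A.nodup
    refine ⟨hl, Finset.val_injective ?_⟩
    rw [List.toFinset_val, hl.dedup, h]; rfl
  · rintro ⟨hl, rfl⟩
    rw [List.toFinset_val, hl.dedup]; rfl

variable {D : M → ℝ} {A : Finset M} {f g : List M → ℝ}

/-- Sums over all preference lists become sums over the orderings of `A`, which allow recursion on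
the first draw; agreement on those orderings suffices. -/
theorem popExpect_eq_listExpect [Fintype M] {X : PrefList M → ℝ}
    (h : ∀ p : PrefList M, p.acceptable = A → X p = f p.1) :
    popExpect D A X = listExpect D A f := by
  unfold popExpect listExpect
  refine Finset.sum_bij_ne_zero (fun p _ _ => p.1) ?_ ?_ ?_ ?_
  · intro p _ hp
    exact mem_lists_toFinset.2 (drawProb_support p.1 (left_ne_zero_of_mul hp))
  · intro p _ _ q _ _ h
    exact Subtype.ext h
  · intro l hl h'
    rw [mem_lists_toFinset] at hl
    refine ⟨⟨l, hl.1⟩, Finset.mem_univ _, ?_, rfl⟩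
    rw [h ⟨l, hl.1⟩ hl.2]
    exact h'
  · intro p _ hp
    rw [h p (drawProb_support p.1 (left_ne_zero_of_mul hp)).2]

theorem listExpect_congr (h : ∀ l : List M, l.Nodup → l.toFinset = A → f l = g l) :
    listExpect D A f = listExpect D A g :=
  Finset.sum_congr rfl fun l hl => by
    rw [mem_lists_toFinset] at hl
    rw [h l hl.1 hl.2]

theorem listExpect_add :
    listExpect D A (fun l => f l + g l) = listExpect D A f + listExpect D A g := by
  simp only [listExpect, mul_add, Finset.sum_add_distrib]

theorem listExpect_sub :
    listExpect D A (fun l => f l - g l) = listExpect D A f - listExpect D A g := by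
  simp only [listExpect, mul_sub, Finset.sum_sub_distrib]

theorem listExpect_mul_const (c : ℝ) :
    listExpect D A (fun l => f l * c) = listExpect D A f * c := by
  simp only [listExpect, Finset.sum_mul, mul_assoc]

theorem listExpect_sum {ι : Type*} (s : Finset ι) (F : ι → List M → ℝ) :
    listExpect D A (fun l => ∑ i ∈ s, F i l) = ∑ i ∈ s, listExpect D A (F i) := by
  simp only [listExpect, Finset.mul_sum]
  exact Finset.sum_comm

theorem listExpect_nonneg (hD : ∀ m ∈ A, 0 < D m) (hf : ∀ l, 0 ≤ f l) :
    0 ≤ listExpect D A f :=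
  Finset.sum_nonneg fun l _ => mul_nonneg (drawProb_nonneg l hD) (hf l)

theorem listExpect_empty : listExpect D ∅ f = f [] := by
  have : (∅ : Finset M).val.lists.toFinset = {[]} := by
    ext l
    rw [mem_lists_toFinset, Finset.mem_singleton, List.toFinset_eq_empty_iff]
    exact ⟨fun h => h.2, fun h => by simp [h]⟩
  rw [listExpect, this]; simp [drawProb]

/-- Conditioning on the first draw. -/
theorem listExpect_eq_sum (hA : A.Nonempty) :
    listExpect D A f =
      ∑ a ∈ A, D a / (∑ b ∈ A, D b) * listExpect D (A.erase a) (fun l => f (a :: l)) := by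
  have hd : ∀ a ∈ A, D a / (∑ b ∈ A, D b) * listExpect D (A.erase a) (fun l => f (a :: l)) =
      ∑ l ∈ (A.erase a).val.lists.toFinset, drawProb D A (a :: l) * f (a :: l) := by
    intro a ha
    simp only [listExpect, drawProb, ha, if_true, Finset.mul_sum, mul_assoc]
  rw [Finset.sum_congr rfl hd,
    ← Finset.sum_sigma A (fun a => (A.erase a).val.lists.toFinset)
      (fun x => drawProb D A (x.1 :: x.2) * f (x.1 :: x.2))]
  symm
  refine Finset.sum_bij (fun x _ => x.1 :: x.2) ?_ ?_ ?_ (fun _ _ => rfl)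
  · rintro ⟨a, l⟩ hx
    rw [Finset.mem_sigma, mem_lists_toFinset] at hx
    obtain ⟨ha, hl, hA⟩ := hx
    rw [mem_lists_toFinset]
    dsimp only at ha hl hA ⊢
    rw [List.nodup_cons, List.toFinset_cons, hA, Finset.insert_erase ha, ← List.mem_toFinset, hA]
    simp [hl]
  · rintro ⟨a, l⟩ _ ⟨b, l'⟩ _ h
    simp only [List.cons.injEq] at h
    obtain ⟨rfl, rfl⟩ := h
    rfl
  · intro l hl
    rw [mem_lists_toFinset] at hl
    obtain ⟨hl, rfl⟩ := hl
    cases l with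
    | nil => simp at hA
    | cons a l =>
      rw [List.nodup_cons] at hl
      refine ⟨⟨a, l⟩, ?_, rfl⟩
      rw [Finset.mem_sigma, mem_lists_toFinset]
      simp [hl]

theorem sum_mul_listExpect (hD : ∀ m ∈ A, 0 < D m) :
    ∑ a ∈ A, D a * listExpect D (A.erase a) (fun l => f (a :: l)) =
      (∑ b ∈ A, D b) * listExpect D A f := by
  rcases A.eq_empty_or_nonempty with rfl | hA
  · simp
  · have hpos : 0 < ∑ b ∈ A, D b := Finset.sum_pos hD hA
    rw [listExpect_eq_sum hA, Finset.mul_sum]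
    refine Finset.sum_congr rfl fun a _ => ?_
    field_simp

theorem listExpect_const (hD : ∀ m ∈ A, 0 < D m) (c : ℝ) :
    listExpect D A (fun _ => c) = c := by
  induction A using Finset.strongInduction with
  | H A ih =>
    rcases A.eq_empty_or_nonempty with rfl | hA
    · exact listExpect_empty
    · have hpos : 0 < ∑ b ∈ A, D b := Finset.sum_pos hD hA
      rw [listExpect_eq_sum hA, Finset.sum_congr rfl fun a ha => by
        rw [ih _ (Finset.erase_ssubset ha) fun m hm => hD m (Finset.mem_of_mem_erase hm)],
        ← Finset.sum_mul, ← Finset.sum_div, div_self hpos.ne', one_mul]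

/-- The restriction of the random list to a subset is distributed as the random list of that
subset. -/
theorem listExpect_filter (hD : ∀ m ∈ A, 0 < D m) {Q : Finset M} (hQ : Q ⊆ A) :
    listExpect D A (fun l => f (l.filter (· ∈ Q))) = listExpect D Q f := by
  induction A using Finset.strongInduction generalizing Q f with
  | H A ih =>
    rcases A.eq_empty_or_nonempty with rfl | hA
    · obtain rfl := Finset.subset_empty.1 hQ
      simp [listExpect_empty]
    · have hpos : 0 < ∑ b ∈ A, D b := Finset.sum_pos hD hA
      have hin : ∀ a ∈ Q, listExpect D (A.erase a) (fun l => f ((a :: l).filter (· ∈ Q))) =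
          listExpect D (Q.erase a) (fun l => f (a :: l)) := by
        intro a ha
        rw [← ih _ (Finset.erase_ssubset (hQ ha)) (fun m hm => hD m (Finset.mem_of_mem_erase hm))
          (Finset.erase_subset_erase a hQ)]
        refine listExpect_congr fun l hl hl' => ?_
        rw [List.filter_cons_of_pos (by simpa using ha)]
        congr 2
        refine List.filter_congr fun b hb => ?_
        have : b ≠ a := by
          rw [← List.mem_toFinset, hl'] at hb
          exact Finset.ne_of_mem_erase hb
        simp [this]
      -- A first draw outside `Q` leaves the filtered list unaffected; a first draw inside `Q` has
      -- the same relative weights as the first draw from `Q` itself.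
      have hout : ∀ a ∈ A \ Q, listExpect D (A.erase a) (fun l => f ((a :: l).filter (· ∈ Q))) =
          listExpect D Q f := by
        intro a ha
        rw [Finset.mem_sdiff] at ha
        rw [← ih _ (Finset.erase_ssubset ha.1) (fun m hm => hD m (Finset.mem_of_mem_erase hm))
          (Finset.subset_erase.2 ⟨hQ, ha.2⟩)]
        refine listExpect_congr fun l _ _ => ?_
        rw [List.filter_cons_of_neg (by simpa using ha.2)]
      refine mul_left_cancel₀ hpos.ne' ?_
      rw [← sum_mul_listExpect hD, ← Finset.sum_sdiff hQ,
        Finset.sum_congr rfl fun a ha => by rw [hout a ha],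
        Finset.sum_congr (rfl : Q = Q) fun a ha => by rw [hin a ha],
        sum_mul_listExpect fun m hm => hD m (hQ hm), ← Finset.sum_mul, ← add_mul,
        Finset.sum_sdiff hQ]

/-- The man drawn first among `S` is `y` with probability proportional to his popularity,
independently of the order of a subset of `S` that does not contain `y`. -/
theorem listExpect_filter_mul_find (hD : ∀ m ∈ A, 0 < D m) {Q S : Finset M} (hQ : Q ⊆ S)
    (hS : S ⊆ A) {y : M} (hyS : y ∈ S) (hyQ : y ∉ Q) :
    listExpect D A (fun l => f (l.filter (· ∈ Q)) *
      if l.find? (· ∈ S) = some y then 1 else 0) = listExpect D Q f * (D y / ∑ b ∈ S, D b) := by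
  have hposS : 0 < ∑ b ∈ S, D b := Finset.sum_pos (fun m hm => hD m (hS hm)) ⟨y, hyS⟩
  induction A using Finset.strongInduction with
  | H A ih =>
    have hpos : 0 < ∑ b ∈ A, D b := Finset.sum_pos hD ⟨y, hS hyS⟩
    have hout : ∀ a ∈ A \ S, listExpect D (A.erase a) (fun l => f ((a :: l).filter (· ∈ Q)) *
        if (a :: l).find? (· ∈ S) = some y then 1 else 0) =
        listExpect D Q f * (D y / ∑ b ∈ S, D b) := by
      intro a ha
      rw [Finset.mem_sdiff] at ha
      rw [← ih _ (Finset.erase_ssubset ha.1) (fun m hm => hD m (Finset.mem_of_mem_erase hm))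
        (Finset.subset_erase.2 ⟨hS, ha.2⟩)]
      refine listExpect_congr fun l _ _ => ?_
      rw [List.filter_cons_of_neg (by simpa using fun h => ha.2 (hQ h)),
        List.find?_cons_of_neg (by simpa using ha.2)]
    -- A first draw from `S` ends the search. If it is `y`, then `y ∉ Q` leaves the order of `Q`
    -- entirely to the remaining draws, which is the source of the independence.
    have hin : ∀ a ∈ S, listExpect D (A.erase a) (fun l => f ((a :: l).filter (· ∈ Q)) *
        if (a :: l).find? (· ∈ S) = some y then 1 else 0) =
        if a = y then listExpect D Q f else 0 := by
      intro a ha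
      split_ifs with hay
      · subst hay
        rw [← listExpect_filter (f := f)
          (fun m hm => hD m (Finset.mem_of_mem_erase hm : m ∈ A))
          (Finset.subset_erase.2 ⟨hQ.trans hS, hyQ⟩)]
        refine listExpect_congr fun l _ _ => ?_
        rw [List.filter_cons_of_neg (by simpa using hyQ), List.find?_cons_of_pos (by simpa using ha)]
        simp
      · refine Finset.sum_eq_zero fun l _ => ?_
        dsimp only
        rw [List.find?_cons_of_pos (by simpa using ha)]
        simp [hay]
    have hsum := sum_mul_listExpect (D := D) (f := fun l => f (l.filter (· ∈ Q)) *
      if l.find? (· ∈ S) = some y then 1 else 0) hD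
    have hsumS := Finset.sum_congr (rfl : S = S) fun a ha => congrArg (D a * ·) (hin a ha)
    have hsumO := Finset.sum_congr (rfl : A \ S = A \ S) fun a ha =>
      congrArg (D a * ·) (hout a ha)
    simp only [mul_ite, mul_zero, Finset.sum_ite_eq', hyS, if_true] at hsumS
    rw [← Finset.sum_mul] at hsumO
    refine mul_left_cancel₀ hpos.ne' ?_
    rw [← hsum, ← Finset.sum_sdiff hS]
    refine (congrArg₂ (· + ·) hsumO ?_).trans (b := (∑ a ∈ A \ S, D a) *
      (listExpect D Q f * (D y / ∑ b ∈ S, D b)) + D y * listExpect D Q f) ?_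
    · rw [← hsumS]; simp only [mul_ite, mul_one, mul_zero]
    · rw [← Finset.sum_sdiff hS (f := D)]
      field_simp

theorem listExpect_find (hD : ∀ m ∈ A, 0 < D m) {S : Finset M} (hS : S ⊆ A) {y : M}
    (hy : y ∈ S) :
    listExpect D A (fun l => if l.find? (· ∈ S) = some y then 1 else 0) =
      D y / ∑ b ∈ S, D b := by
  have := listExpect_filter_mul_find (f := fun _ => 1) hD (Finset.empty_subset S) hS hy
    (Finset.notMem_empty y)
  simpa [listExpect_empty] using this

theorem find?_eq_some_iff_idxOf {l : List M} {S : Finset M} {x : M} (hx : x ∈ S) (hl : x ∈ l) :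
    l.find? (· ∈ S) = some x ↔ ∀ y ∈ S, y ≠ x → l.idxOf x < l.idxOf y := by
  induction l with
  | nil => simp at hl
  | cons a l ih =>
    by_cases ha : a ∈ S
    · rw [List.find?_cons_of_pos (by simpa using ha)]
      constructor
      · rintro ⟨⟩ y _ hy
        rw [List.idxOf_cons_self, List.idxOf_cons_ne _ hy.symm]
        exact Nat.succ_pos _
      · intro h
        by_contra hne
        have := h a ha (fun h => hne (by rw [h]))
        simp at this
    · have hxa : a ≠ x := fun h => ha (h ▸ hx)
      rw [List.find?_cons_of_neg (by simpa using ha),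
        ih ((List.mem_cons.1 hl).resolve_left hxa.symm)]
      refine forall₃_congr fun y hy _ => ?_
      have hya : a ≠ y := fun h => ha (h ▸ hy)
      rw [List.idxOf_cons_ne _ hxa, List.idxOf_cons_ne _ hya, Nat.succ_lt_succ_iff]

end RandomOrder

/-! ### Two logarithmic inequalities -/

/-- A sum of the form `∑ Δs / s` is at most the corresponding difference of logarithms. -/
theorem sum_div_partial_sum_le_log {ι : Type*} [DecidableEq ι] (k : ι → ℕ) (d : ι → ℝ) {s : ℝ}
    (hs : 0 < s) (Y : Finset ι) (hd : ∀ y ∈ Y, 0 < d y) :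
    ∑ y ∈ Y, d y / (s + ∑ z ∈ Y.filter (fun z => k z ≤ k y), d z) ≤
      Real.log (s + ∑ y ∈ Y, d y) - Real.log s := by
  induction Y using Finset.induction_on_max_value k with
  | empty => simp
  | insert a Y ha hmax ih =>
    have hdY : ∀ y ∈ Y, 0 < d y := fun y hy => hd y (Finset.mem_insert_of_mem hy)
    have hda := hd a (Finset.mem_insert_self a Y)
    have hY : 0 ≤ ∑ y ∈ Y, d y := Finset.sum_nonneg fun y hy => (hdY y hy).le
    have hfil : (insert a Y).filter (fun z => k z ≤ k a) = insert a Y :=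
      Finset.filter_true_of_mem fun z hz => by
        rcases Finset.mem_insert.1 hz with rfl | hz
        exacts [le_rfl, hmax z hz]
    rw [Finset.sum_insert ha, hfil, Finset.sum_insert ha]
    -- The new element has the largest key, so it enters only the denominators of elements tied with
    -- it, and only enlarges them.
    have h1 : ∑ y ∈ Y, d y / (s + ∑ z ∈ (insert a Y).filter (fun z => k z ≤ k y), d z) ≤
        ∑ y ∈ Y, d y / (s + ∑ z ∈ Y.filter (fun z => k z ≤ k y), d z) := by
      refine Finset.sum_le_sum fun y hy => ?_
      have h0 : 0 ≤ ∑ z ∈ Y.filter (fun z => k z ≤ k y), d z :=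
        Finset.sum_nonneg fun z hz => (hdY z (Finset.mem_filter.1 hz).1).le
      refine div_le_div_of_nonneg_left (hdY y hy).le (by linarith) ?_
      gcongr
      · intro z hz _
        exact (hd z (Finset.mem_filter.1 hz).1).le
      · exact Finset.subset_insert a Y
    have h2 := ih hdY
    have h3 : d a / (s + (d a + ∑ y ∈ Y, d y)) ≤
        Real.log (s + (d a + ∑ y ∈ Y, d y)) - Real.log (s + ∑ y ∈ Y, d y) := by
      rw [← Real.log_div (by linarith) (by linarith)]
      refine le_trans (le_of_eq ?_) (Real.one_sub_inv_le_log_of_pos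
        (div_pos (by linarith) (by linarith)))
      have : s + (d a + ∑ y ∈ Y, d y) ≠ 0 := by linarith
      rw [inv_div]
      field_simp
      ring
    linarith

/-- The entropy of a probability distribution on `X` is at most `log |X|`. -/
theorem log_sum_sub_le_log_card {ι : Type*} {X : Finset ι} (hX : X.Nonempty) {d : ι → ℝ}
    (hd : ∀ x ∈ X, 0 < d x) :
    Real.log (∑ x ∈ X, d x) - ∑ x ∈ X, d x / (∑ b ∈ X, d b) * Real.log (d x) ≤
      Real.log (X.card : ℝ) := by
  set s := ∑ b ∈ X, d b with hs_def
  have hs : 0 < s := Finset.sum_pos hd hX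
  have hn : (0 : ℝ) < X.card := by exact_mod_cast hX.card_pos
  have h1 : ∑ x ∈ X, d x / s = 1 := by rw [← Finset.sum_div, div_self hs.ne']
  -- Gibbs' inequality against the uniform distribution: ln t ≤ t − 1 at t = s / (d x · |X|),
  -- weighted by d x / s.
  have h2 : ∀ x ∈ X, d x / s * (Real.log s - Real.log (d x) - Real.log X.card) ≤
      1 / X.card - d x / s := by
    intro x hx
    have hdx := hd x hx
    have := Real.log_le_sub_one_of_pos (div_pos hs (mul_pos hdx hn))
    rw [Real.log_div hs.ne' (mul_pos hdx hn).ne', Real.log_mul hdx.ne' hn.ne'] at this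
    calc d x / s * (Real.log s - Real.log (d x) - Real.log X.card)
        ≤ d x / s * (s / (d x * X.card) - 1) :=
          mul_le_mul_of_nonneg_left (by linarith) (div_pos hdx hs).le
      _ = 1 / X.card - d x / s := by field_simp
  have h3 := Finset.sum_le_sum h2
  rw [Finset.sum_sub_distrib, h1, Finset.sum_const, nsmul_eq_mul, mul_one_div_cancel hn.ne',
    sub_self] at h3
  simp only [mul_sub, Finset.sum_sub_distrib, ← Finset.sum_mul, h1, one_mul] at h3
  linarith

/-! ### Counting successful candidates -/

section Competitors

variable {M : Type*} [DecidableEq M]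

/-- A set `X` of candidates, each with a set `C x` of competitors. In a list, the candidate `x`
succeeds if he comes first among his competitors. -/
structure IsCompetition (X : Finset M) (C : M → Finset M) : Prop where
  mem_self : ∀ x ∈ X, x ∈ C x
  subset : ∀ x ∈ X, C x ⊆ X
  of_notMem : ∀ x ∈ X, ∀ y ∈ X, y ∉ C x → C x ⊆ C y ∧ x ∈ C y

/-- `h` succeeds in the list `l`, and nobody else succeeds with a subset of the competitors. -/
def IsLowest (X : Finset M) (C : M → Finset M) (l : List M) (h : M) : Prop :=
  l.find? (· ∈ C h) = some h ∧
    ∀ y ∈ X, y ≠ h → C y ⊆ C h → l.find? (· ∈ C y) ≠ some y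

theorem find?_filter_mem {l : List M} {S Q : Finset M} (h : S ⊆ Q) :
    (l.filter (· ∈ Q)).find? (· ∈ S) = l.find? (· ∈ S) := by
  rw [List.find?_filter]
  congr 1
  funext a
  simpa using fun ha => h ha

/-- Being lowest involves only competitor sets inside `C h`, so it is decided by the order of `C h`;
this makes the independence lemma applicable. -/
theorem isLowest_filter {X : Finset M} {C : M → Finset M} {l : List M} {h : M} :
    IsLowest X C (l.filter (· ∈ C h)) h ↔ IsLowest X C l h := by
  unfold IsLowest
  rw [find?_filter_mem subset_rfl]
  refine and_congr_right fun _ => forall₄_congr fun y _ _ hy => ?_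
  rw [find?_filter_mem hy]

theorem find?_eq_some_iff_of_subset {A S : Finset M} {l : List M} (hl : l.toFinset = A)
    (hS : S ⊆ A) {x : M} (hx : x ∈ S) :
    l.find? (· ∈ S) = some x ↔ ∀ y ∈ S, y ≠ x → l.idxOf x < l.idxOf y :=
  find?_eq_some_iff_idxOf hx (List.mem_toFinset.1 (hl ▸ hS hx))

/-- Take a successful candidate with the fewest competitors. Another one with a subset of them would
have the same set, and hence be the same first man. -/
theorem exists_isLowest {X : Finset M} {C : M → Finset M} {l : List M}
    (hs : ∃ x ∈ X, l.find? (· ∈ C x) = some x) :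
    ∃ h ∈ X, IsLowest X C l h := by
  obtain ⟨x, hx, hfx⟩ := hs
  obtain ⟨h, hh, hmin⟩ := (X.filter fun x => l.find? (· ∈ C x) = some x).exists_min_image
    (fun x => (C x).card) ⟨x, Finset.mem_filter.2 ⟨hx, hfx⟩⟩
  rw [Finset.mem_filter] at hh
  refine ⟨h, hh.1, hh.2, fun y hy hyh hsub hfy => hyh ?_⟩
  have heq := Finset.eq_of_subset_of_card_le hsub (hmin y (Finset.mem_filter.2 ⟨hy, hfy⟩))
  rw [heq] at hfy
  exact Option.some.inj (hfy.symm.trans hh.2)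

namespace IsCompetition

variable {X A : Finset M} {C : M → Finset M} {l : List M}

/-- Otherwise `C y ⊆ C x`, strictly because `x` lies only in the latter. Ordering by cardinality
thus replaces a linear order on the candidates. -/
theorem mem_of_card_le (hC : IsCompetition X C) {x y : M} (hx : x ∈ X) (hy : y ∈ X) (h : (C x).card ≤ (C y).card) :
    x ∈ C y := by
  by_contra hxy
  obtain ⟨h1, h2⟩ := hC.of_notMem y hy x hx hxy
  exact absurd h (not_le.2 (Finset.card_lt_card
    ⟨h1, fun h' => hxy (h' (hC.mem_self x hx))⟩))

/-- The successful candidates other than the lowest one do not compete with him, and precede him. -/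
theorem idxOf_lt_of_isLowest (hC : IsCompetition X C) (hXA : X ⊆ A) (hl : l.toFinset = A) {h y : M} (hh : h ∈ X)
    (hlow : IsLowest X C l h) (hy : y ∈ X) (hyh : y ≠ h) (hfy : l.find? (· ∈ C y) = some y) :
    y ∉ C h ∧ l.idxOf y < l.idxOf h := by
  have hhy : h ∈ C y := by
    by_contra hn
    exact hlow.2 y hy hyh (hC.of_notMem y hy h hh hn).1 hfy
  have h1 := (find?_eq_some_iff_of_subset hl ((hC.subset y hy).trans hXA)
    (hC.mem_self y hy)).1 hfy h hhy hyh.symm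
  refine ⟨fun hyC => ?_, h1⟩
  exact h1.asymm ((find?_eq_some_iff_of_subset hl ((hC.subset h hh).trans hXA)
    (hC.mem_self h hh)).1 hlow.1 y hyC hyh)

/-- Of two different lowest candidates, each would precede the other in the list. -/
theorem isLowest_unique (hC : IsCompetition X C) (hXA : X ⊆ A) (hl : l.toFinset = A) {h h' : M} (hh : h ∈ X)
    (hh' : h' ∈ X) (hlow : IsLowest X C l h) (hlow' : IsLowest X C l h') : h' = h := by
  by_contra hne
  exact (hC.idxOf_lt_of_isLowest hXA hl hh hlow hh' hne hlow'.1).2.asymm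
    (hC.idxOf_lt_of_isLowest hXA hl hh' hlow' hh (Ne.symm hne) hlow.1).2

/-- The number of successful candidates, counted from the lowest one. -/
theorem card_eq (hC : IsCompetition X C) (hXA : X ⊆ A) (hl : l.toFinset = A) {h : M} (hh : h ∈ X)
    (hlow : IsLowest X C l h) :
    ((X.filter fun x => l.find? (· ∈ C x) = some x).card : ℝ) =
      1 + ∑ y ∈ X \ C h, if l.find? (· ∈ C y) = some y then 1 else 0 := by
  rw [Finset.sum_boole]
  have : (X.filter fun x => l.find? (· ∈ C x) = some x) =
      insert h ((X \ C h).filter fun x => l.find? (· ∈ C x) = some x) := by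
    ext y
    simp only [Finset.mem_filter, Finset.mem_insert, Finset.mem_sdiff]
    constructor
    · rintro ⟨hy, hfy⟩
      by_cases hyh : y = h
      · exact Or.inl hyh
      · exact Or.inr ⟨⟨hy, (hC.idxOf_lt_of_isLowest hXA hl hh hlow hy hyh hfy).1⟩, hfy⟩
    · rintro (rfl | ⟨⟨hy, _⟩, hfy⟩)
      exacts [⟨hh, hlow.1⟩, ⟨hy, hfy⟩]
  rw [this, Finset.card_insert_of_notMem (by simp [hC.mem_self h hh])]
  push_cast
  ring

variable {D : M → ℝ}

/-- Adding the candidates outside `C h` by increasing size of their competitor sets, each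
denominator is at least the weight of `C h` plus that of all candidates up to `y`, ties included.
The sum is then bounded by a logarithm, and `C h` weighs at least as much as `h`. -/
theorem sum_div_le_log (hC : IsCompetition X C) (hD : ∀ m ∈ X, 0 < D m) {h : M} (hh : h ∈ X) :
    ∑ y ∈ X \ C h, D y / ∑ b ∈ C y, D b ≤ Real.log (∑ b ∈ X, D b) - Real.log (D h) := by
  have hDC : ∀ y ∈ X, ∀ m ∈ C y, 0 < D m := fun y hy m hm => hD m (hC.subset y hy hm)
  have hs : 0 < ∑ b ∈ C h, D b := Finset.sum_pos (hDC h hh) ⟨h, hC.mem_self h hh⟩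
  have h1 := sum_div_partial_sum_le_log (fun y => (C y).card) D hs (X \ C h)
    fun y hy => hD y (Finset.mem_sdiff.1 hy).1
  rw [add_comm (∑ b ∈ C h, D b) (∑ y ∈ X \ C h, D y), Finset.sum_sdiff (hC.subset h hh)] at h1
  have h2 : Real.log (D h) ≤ Real.log (∑ b ∈ C h, D b) :=
    Real.log_le_log (hD h hh) (Finset.single_le_sum (fun m hm => (hDC h hh m hm).le)
      (hC.mem_self h hh))
  refine le_trans (Finset.sum_le_sum fun y hy => ?_) (h1.trans (by linarith))
  rw [Finset.mem_sdiff] at hy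
  have hdisj : Disjoint (C h) ((X \ C h).filter fun z => (C z).card ≤ (C y).card) :=
    Finset.disjoint_left.2 fun z hz hz' =>
      (Finset.mem_sdiff.1 (Finset.mem_filter.1 hz').1).2 hz
  rw [← Finset.sum_union hdisj]
  refine div_le_div_of_nonneg_left (hD y hy.1).le
    (Finset.sum_pos ?_ ⟨h, Finset.mem_union_left _ (hC.mem_self h hh)⟩)
    (Finset.sum_le_sum_of_subset_of_nonneg ?_ fun m hm _ => (hDC y hy.1 m hm).le)
  · intro z hz
    rcases Finset.mem_union.1 hz with hz | hz
    · exact hDC h hh z hz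
    · exact hD z (Finset.mem_sdiff.1 (Finset.mem_filter.1 hz).1).1
  · refine Finset.union_subset (hC.of_notMem h hh y hy.1 hy.2).1 fun z hz => ?_
    rw [Finset.mem_filter, Finset.mem_sdiff] at hz
    exact hC.mem_of_card_le hz.1.1 hy.1 hz.2

/-- The expected number of successful candidates in terms of the popularity of the lowest one. -/
theorem listExpect_card_le (hC : IsCompetition X C) (hD : ∀ m ∈ A, 0 < D m) (hXA : X ⊆ A) {low : List M → M}
    (hlow : ∀ l : List M, l.Nodup → l.toFinset = A → low l ∈ X ∧ IsLowest X C l (low l)) :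
    listExpect D A (fun l => ((X.filter fun x => l.find? (· ∈ C x) = some x).card : ℝ)) ≤
      1 + Real.log (∑ b ∈ X, D b) - listExpect D A (fun l => Real.log (D (low l))) := by
  classical
  -- Exactly one candidate is lowest, so the sum over `h` splits according to who it is.
  have hsum : ∀ l : List M, l.Nodup → l.toFinset = A → ∀ F : M → ℝ,
      ∑ h ∈ X, (if IsLowest X C l h then 1 else 0) * F h = F (low l) := by
    intro l hl hlA F
    obtain ⟨h1, h2⟩ := hlow l hl hlA
    rw [Finset.sum_eq_single_of_mem _ h1 fun b hb hne => ?_]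
    · simp [h2]
    · rw [if_neg fun hb' => hne (hC.isLowest_unique hXA hlA h1 hb h2 hb'), zero_mul]
  -- For `y ∉ C h` the success of `y` is independent of the order within `C h`, hence of the event
  -- that `h` is lowest.
  have hprob : ∀ h ∈ X, listExpect D A (fun l => (if IsLowest X C l h then 1 else 0) *
      (1 + ∑ y ∈ X \ C h, if l.find? (· ∈ C y) = some y then 1 else 0)) =
      listExpect D A (fun l => if IsLowest X C l h then 1 else 0) *
        (1 + ∑ y ∈ X \ C h, D y / ∑ b ∈ C y, D b) := by
    intro h hh
    simp only [mul_add, mul_one, Finset.mul_sum, listExpect_add, listExpect_sum]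
    congr 1
    refine Finset.sum_congr rfl fun y hy => ?_
    rw [Finset.mem_sdiff] at hy
    have h1 := listExpect_filter_mul_find (f := fun l => if IsLowest X C l h then 1 else 0) hD
      (hC.of_notMem h hh y hy.1 hy.2).1 ((hC.subset y hy.1).trans hXA) (hC.mem_self y hy.1) hy.2
    rw [← listExpect_filter (Q := C h) hD ((hC.subset h hh).trans hXA)] at h1
    simpa only [isLowest_filter] using h1
  calc listExpect D A (fun l => ((X.filter fun x => l.find? (· ∈ C x) = some x).card : ℝ))
      = listExpect D A (fun l => ∑ h ∈ X, (if IsLowest X C l h then 1 else 0) *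
          (1 + ∑ y ∈ X \ C h, if l.find? (· ∈ C y) = some y then 1 else 0)) := by
        refine listExpect_congr fun l hl hlA => ?_
        rw [hsum l hl hlA]
        exact hC.card_eq hXA hlA (hlow l hl hlA).1 (hlow l hl hlA).2
    _ = ∑ h ∈ X, listExpect D A (fun l => if IsLowest X C l h then 1 else 0) *
          (1 + ∑ y ∈ X \ C h, D y / ∑ b ∈ C y, D b) := by
        rw [listExpect_sum]
        exact Finset.sum_congr rfl hprob
    _ ≤ ∑ h ∈ X, listExpect D A (fun l => if IsLowest X C l h then 1 else 0) *
          (1 + (Real.log (∑ b ∈ X, D b) - Real.log (D h))) := by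
        refine Finset.sum_le_sum fun h hh => mul_le_mul_of_nonneg_left ?_
          (listExpect_nonneg hD fun l => by split_ifs <;> norm_num)
        gcongr
        exact hC.sum_div_le_log (fun m hm => hD m (hXA hm)) hh
    _ = listExpect D A (fun l => 1 + Real.log (∑ b ∈ X, D b) - Real.log (D (low l))) := by
        simp only [← listExpect_mul_const]
        rw [← listExpect_sum]
        refine listExpect_congr fun l hl hlA => ?_
        rw [hsum l hl hlA]
        ring
    _ = _ := by rw [listExpect_sub, listExpect_const hD]

end IsCompetition

/-- The expected logarithm of the popularity of the man of `X` drawn first. -/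
theorem log_sum_le_listExpect_log {D : M → ℝ} {A X : Finset M} (hD : ∀ m ∈ A, 0 < D m)
    (hXA : X ⊆ A) (hX : X.Nonempty) {first : List M → M}
    (hfirst : ∀ l : List M, l.Nodup → l.toFinset = A → l.find? (· ∈ X) = some (first l)) :
    Real.log (∑ b ∈ X, D b) ≤
      Real.log (A.card : ℝ) + listExpect D A (fun l => Real.log (D (first l))) := by
  have h1 := log_sum_sub_le_log_card hX fun x hx => hD x (hXA hx)
  have h2 : Real.log (X.card : ℝ) ≤ Real.log (A.card : ℝ) :=
    Real.log_le_log (by exact_mod_cast hX.card_pos) (by exact_mod_cast Finset.card_le_card hXA)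
  have h3 : listExpect D A (fun l => Real.log (D (first l))) =
      ∑ x ∈ X, D x / (∑ b ∈ X, D b) * Real.log (D x) := by
    calc listExpect D A (fun l => Real.log (D (first l)))
        = listExpect D A (fun l => ∑ x ∈ X, (if l.find? (· ∈ X) = some x then 1 else 0) *
            Real.log (D x)) := by
          refine listExpect_congr fun l hl hlA => ?_
          have h := hfirst l hl hlA
          have hmem : first l ∈ X := by simpa using List.find?_some h
          simp [h, hmem]
      _ = _ := by
          rw [listExpect_sum]
          refine Finset.sum_congr rfl fun x hx => ?_
          rw [listExpect_mul_const, listExpect_find hD hXA hx]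
  linarith

end Competitors

/-! ### Assembling the bound -/

theorem theorem3 {M W : Type*} [Fintype M] [DecidableEq M] [Fintype W] [DecidableEq W]
    (pM : M → PrefList W) (pW : W → PrefList M) (w : W)
    (A : Finset M) (D : M → ℝ) (hD : ∀ m ∈ A, 0 < D m)
    (hw : ∃ p : PrefList M, p.acceptable = A ∧
      ∃ m, IsStableHusband pM (Function.update pW w p) w m) :
    ∃ best worst : PrefList M → M,
      (∀ p : PrefList M, p.acceptable = A →
        IsBestStableHusband pM (Function.update pW w p) w (best p) ∧
        IsWorstStableHusband pM (Function.update pW w p) w (worst p)) ∧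
      popExpect D A (fun p => (numStableHusbands pM (Function.update pW w p) w : ℝ)) ≤
        1 + Real.log (A.card : ℝ) +
          popExpect D A (fun p => Real.log (D (best p) / D (worst p))) := by
  obtain ⟨X, C, hXA, hself, hnot, hiff⟩ := exists_competitors pM pW w A
  have hC : IsCompetition X C := ⟨fun x hx => (hself x hx).1, fun x hx => (hself x hx).2, hnot⟩
  obtain ⟨p₀, hp₀, m₀, hm₀⟩ := hw
  have hX : X.Nonempty := ⟨m₀, ((hiff p₀ hp₀ m₀).1 hm₀).1⟩
  have hCA : ∀ x ∈ X, C x ⊆ A := fun x hx => (hC.subset x hx).trans hXA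
  have hhus : ∀ p : PrefList M, p.acceptable = A → ∀ x,
      IsStableHusband pM (Function.update pW w p) w x ↔
        x ∈ X ∧ p.1.find? (· ∈ C x) = some x := by
    intro p hp x
    rw [hiff p hp x]
    exact and_congr_right fun hx =>
      (find?_eq_some_iff_of_subset hp (hCA x hx) (hC.mem_self x hx)).symm
  have hfirst : ∀ l : List M, ∃ b, l.toFinset = A → l.find? (· ∈ X) = some b := by
    intro l
    by_cases hl : l.toFinset = A
    · obtain ⟨x, hx⟩ := hX
      have hsome : (l.find? (· ∈ X)).isSome := by
        rw [List.find?_isSome]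
        exact ⟨x, List.mem_toFinset.1 (hl ▸ hXA hx), by simpa using hx⟩
      exact ⟨_, fun _ => (Option.some_get hsome).symm⟩
    · exact ⟨m₀, fun h => absurd h hl⟩
  choose first hfirst using hfirst
  have hfirst_mem : ∀ l : List M, l.toFinset = A → first l ∈ X := fun l hl => by
    simpa using List.find?_some (hfirst l hl)
  have hfirst_lt : ∀ l : List M, l.toFinset = A → ∀ y ∈ X, y ≠ first l →
      l.idxOf (first l) < l.idxOf y := fun l hl =>
    (find?_eq_some_iff_of_subset hl hXA (hfirst_mem l hl)).1 (hfirst l hl)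
  -- The first man of `X` succeeds because his competitors all lie in `X`; he is therefore the best
  -- stable husband.
  have hfirst_succ : ∀ l : List M, l.toFinset = A →
      l.find? (· ∈ C (first l)) = some (first l) := fun l hl =>
    (find?_eq_some_iff_of_subset hl (hCA _ (hfirst_mem l hl)) (hC.mem_self _ (hfirst_mem l hl))).2
      fun y hy => hfirst_lt l hl y (hC.subset _ (hfirst_mem l hl) hy)
  have hlow : ∀ l : List M, ∃ h, l.toFinset = A → h ∈ X ∧ IsLowest X C l h := by
    intro l
    by_cases hl : l.toFinset = A
    · obtain ⟨h, hh⟩ := exists_isLowest ⟨first l, hfirst_mem l hl, hfirst_succ l hl⟩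
      exact ⟨h, fun _ => hh⟩
    · exact ⟨m₀, fun h => absurd h hl⟩
  choose low hlow using hlow
  have hpref : ∀ p : PrefList M, p.acceptable = A → ∀ x ∈ X, ∀ y,
      p.1.idxOf x < p.1.idxOf y →
        (Function.update pW w p w).Prefers (some x) (some y) := by
    intro p hp x hx y h
    rw [Function.update_self]
    exact ⟨PrefList.mem_acceptable.1 (hp ▸ hXA hx), fun _ => h⟩
  refine ⟨fun p => first p.1, fun p => low p.1, fun p hp => ⟨⟨?_, ?_⟩, ⟨?_, ?_⟩⟩, ?_⟩
  · exact (hhus p hp _).2 ⟨hfirst_mem _ hp, hfirst_succ _ hp⟩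
  · intro y hy hne
    exact hpref p hp _ (hfirst_mem _ hp) y (hfirst_lt _ hp y ((hhus p hp y).1 hy).1 hne)
  · exact (hhus p hp _).2 ⟨(hlow _ hp).1, (hlow _ hp).2.1⟩
  · intro y hy hne
    obtain ⟨hyX, hfy⟩ := (hhus p hp y).1 hy
    exact hpref p hp y hyX _
      (hC.idxOf_lt_of_isLowest hXA hp (hlow _ hp).1 (hlow _ hp).2 hyX hne hfy).2
  · have hnum : popExpect D A
        (fun p => (numStableHusbands pM (Function.update pW w p) w : ℝ)) =
        listExpect D A
          (fun l => ((X.filter fun x => l.find? (· ∈ C x) = some x).card : ℝ)) := by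
      refine popExpect_eq_listExpect fun p hp => ?_
      rw [numStableHusbands, ← Set.ncard_coe_finset]
      congr 2
      ext x
      simp [hhus p hp x]
    have hlog : popExpect D A (fun p => Real.log (D (first p.1) / D (low p.1))) =
        listExpect D A (fun l => Real.log (D (first l))) -
          listExpect D A (fun l => Real.log (D (low l))) := by
      rw [← listExpect_sub]
      refine popExpect_eq_listExpect fun p hp => ?_
      exact Real.log_div (hD _ (hXA (hfirst_mem _ hp))).ne' (hD _ (hXA (hlow _ hp).1)).ne'
    have h1 := hC.listExpect_card_le hD hXA (low := low) fun l _ hl => hlow l hl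
    have h2 := log_sum_le_listExpect_log hD hXA hX (first := first) fun l _ hl => hfirst l hl
    rw [hnum, hlog]
    linarith
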